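/- Let $d\ge 2$ and let $\mathbb{E}^d$ be Euclidean $d$-space. A convex body is a compact convex subset of $\mathbb{E}^d$ with nonempty interior. For a bounded nonempty set $K$ and a hyperplane $H$, let $w(K,H)$ be the distance between the two supporting hyperplanes of $K$ parallel to $H$. For convex bodies $K,C$ put $w_C(K)=\min_H \frac{w(K,H)}{w(C,H)}$, the minimum being over all hyperplanes $H$; let the $C$-inradius $r$ of $K$ be the largest $\rho>0$ such that some translate of $\rho C$ is contained in $K$; and for $0<\rho\le r$ let $K^{\rho C}$ be the union of all translates of $\rho C$ contained in $K$. For an integer $m\ge 1$, the $m$th successive $C$-inradius $r_C(K,m)$ of $K$ is the unique $\rho\in(0,r]$ with $w_C(K^{\rho C})=m\rho$. A convex partition $V_1\cup\dots\cup V_n$ of $\mathbb{E}^d$ is a family of closed convex sets with nonempty, pairwise disjoint interiors whose union is $\mathbb{E}^d$. The partition into the single part $V_1=\mathbb{E}^d$ is inductive; for $n\ge 2$, a convex partition $V_1\cup\dots\cup V_n$ is inductive if for every $1\le i\le n$ there is an inductive partition $W_1\cup\dots\cup W_{i-1}\cup W_{i+1}\cup\dots\cup W_n$ of $\mathbb{E}^d$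 such that $V_j\subseteq W_j$ for all $j\ne i$. **Theorem.** Let $K$ and $C$ be convex bodies in $\mathbb{E}^d$, $d\ge 2$, let $m$ be a positive integer, and let $V_1\cup\dots\cup V_n$ be an inductive partition of $\mathbb{E}^d$ such that $\operatorname{int}(V_i\cap K)\ne\emptyset$ for all $1\le i\le n$. Then the numbers $r_C(K,m)$ and $r_C(V_i\cap K,m)$, $1\le i\le n$, are well defined (the number $\rho$ in the definition exists and is unique), and $$\sum_{i=1}^{n} r_C(V_i\cap K,m)\ \ge\ r_C(K,m).$$ -/

import Mathlib

open scoped Pointwise RealInnerProductSpace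

noncomputable section

/-- A convex body of Euclidean `d`-space: a compact convex set with nonempty interior. -/
structure IsConvexBody {d : ℕ} (K : Set (EuclideanSpace ℝ (Fin d))) : Prop where
  convex : Convex ℝ K
  isCompact : IsCompact K
  interior_nonempty : (interior K).Nonempty

/-- The width of `K` parallel to the hyperplanes with unit normal `u`: the distance between the
two supporting hyperplanes `⟪u, x⟫ = max` and `⟪u, x⟫ = min` of `K`. -/
def widthAlong {d : ℕ} (K : Set (EuclideanSpace ℝ (Fin d))) (u : EuclideanSpace ℝ (Fin d)) : ℝ :=
  sSup ((fun x => ⟪u, x⟫) '' K) - sInf ((fun x => ⟪u, x⟫) '' K)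

/-- The minimal `C`-width of `K`: the minimum of the relative widths `w(K, H) / w(C, H)` over all
hyperplanes `H`, each `H` being given, up to parallelism, by a unit normal vector. -/
def minRelWidth {d : ℕ} (C K : Set (EuclideanSpace ℝ (Fin d))) : ℝ :=
  ⨅ u : Metric.sphere (0 : EuclideanSpace ℝ (Fin d)) 1, widthAlong K u / widthAlong C u

/-- The `C`-inradius of `K`: the factor of the largest positive homothetic copy of `C` a translate
of which is contained in `K`. -/
def relInradius {d : ℕ} (C K : Set (EuclideanSpace ℝ (Fin d))) : ℝ :=
  sSup {ρ : ℝ | 0 < ρ ∧ ∃ t : EuclideanSpace ℝ (Fin d), t +ᵥ ρ • C ⊆ K}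

/-- The `ρC`-rounded body of `K`: the union of all translates of `ρC` that are contained
in `K`. -/
def roundedBody {d : ℕ} (C K : Set (EuclideanSpace ℝ (Fin d))) (ρ : ℝ) :
    Set (EuclideanSpace ℝ (Fin d)) :=
  ⋃ (t : EuclideanSpace ℝ (Fin d)) (_ : t +ᵥ ρ • C ⊆ K), t +ᵥ ρ • C

/-- `ρ` is an `m`th successive `C`-inradius of `K`: `0 < ρ`, `ρ` is at most the `C`-inradius of
`K`, and the minimal `C`-width of the `ρC`-rounded body of `K` equals `m ρ`. -/
structure IsSuccessiveInradius {d : ℕ} (C K : Set (EuclideanSpace ℝ (Fin d))) (m : ℕ) (ρ : ℝ) :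
    Prop where
  pos : 0 < ρ
  le_relInradius : ρ ≤ relInradius C K
  width_eq : minRelWidth C (roundedBody C K ρ) = m * ρ

/-- The `m`th successive `C`-inradius of `K`, i.e. the number `ρ` with
`IsSuccessiveInradius C K m ρ`. It is meaningful when there is exactly one such `ρ`. -/
def successiveInradius {d : ℕ} (C K : Set (EuclideanSpace ℝ (Fin d))) (m : ℕ) : ℝ :=
  Classical.epsilon (fun ρ : ℝ => IsSuccessiveInradius C K m ρ)

/-- A convex partition of Euclidean space: closed convex sets with nonempty, pairwise disjoint
interiors whose union is the whole space. -/
structure IsConvexPartition {d n : ℕ} (V : Fin n → Set (EuclideanSpace ℝ (Fin d))) : Prop where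
  isClosed : ∀ i, IsClosed (V i)
  convex : ∀ i, Convex ℝ (V i)
  interior_nonempty : ∀ i, (interior (V i)).Nonempty
  disjoint_interior : ∀ i j, i ≠ j → Disjoint (interior (V i)) (interior (V j))
  iUnion_eq : ⋃ i, V i = Set.univ

/-- Inductive partitions, by recursion on the number of parts. The partition into one part is
inductive. A convex partition into `n + 2` parts is inductive if for every `i` there is an inductive
partition into `n + 1` parts, indexed by the indices other than `i` (through `i.succAbove`), each
part of which contains the part of the given partition with the same index. -/
def IsInductivePartition {d : ℕ} :
    (n : ℕ) → (Fin n → Set (EuclideanSpace ℝ (Fin d))) → Prop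
  | 0, _ => False
  | 1, V => V 0 = Set.univ
  | n + 2, V => IsConvexPartition V ∧
      ∀ i : Fin (n + 2), ∃ W : Fin (n + 1) → Set (EuclideanSpace ℝ (Fin d)),
        IsInductivePartition (n + 1) W ∧ ∀ j : Fin (n + 1), V (i.succAbove j) ⊆ W j

end

/-! Write `R(L)` for the largest `ρ` such that the set of translation vectors moving `ρ • C` into
`L` has width at least `(m - 1) * ρ` times that of `C` in every direction. The rounded body is this
set plus `ρ • C`, so the condition says that its minimal `C`-width is at least `m * ρ`. On convex
bodies equality holds at the maximum and nowhere else, so `R` is the `m`th successive inradius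
(`isSuccessiveInradius_maxFactor`, `IsSuccessiveInradius.eq_maxFactor`).

In this form `R` makes sense for all compact sets. It is monotone, translation invariant, zero on
sets with empty interior, and concave: `a • L₀ + b • L₁ ⊆ L` with `a, b ≥ 0` and nonempty `L₀`, `L₁`
gives `a R(L₀) + b R(L₁) ≤ R(L)` (`maxFactor_combo`).

The inequality follows by induction on the number of parts (`maxFactor_le_sum`). If some `V i ∩ K`
has empty interior, an inductive partition `W` without index `i` cuts `K` into the same solid pieces
(`subset_of_interior_eq_empty`). Otherwise `K` is slid both ways along a line until some part
degenerates (`IsConvexPartition.exists_slide`). The inequality holds at both end positions. Since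
`K` is a convex combination of these translates and each part is convex, concavity of `R` carries
the inequality back to `K`. -/

/-- The translation vectors that move `ρ • C` into `L`. -/
def erosion {d : ℕ} (C L : Set (EuclideanSpace ℝ (Fin d))) (ρ : ℝ) :
    Set (EuclideanSpace ℝ (Fin d)) :=
  {x | ∀ c ∈ C, x + ρ • c ∈ L}

/-- The factors `ρ ≥ 0` such that in every direction `L` contains two translates of `ρ • C` that
are at least `(m - 1) * ρ` times the width of `C` apart. -/
def admissibleFactors {d : ℕ} (C L : Set (EuclideanSpace ℝ (Fin d))) (m : ℕ) : Set ℝ :=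
  {ρ | 0 ≤ ρ ∧ ∀ u, ‖u‖ = 1 → ∃ x ∈ erosion C L ρ, ∃ y ∈ erosion C L ρ,
    (m - 1 : ℝ) * ρ * widthAlong C u ≤ ⟪u, x - y⟫}

/-! ### Widths and interiors -/

section Support

variable {d : ℕ} {K L C T : Set (EuclideanSpace ℝ (Fin d))} {u : EuclideanSpace ℝ (Fin d)}

lemma inner_sub_le_widthAlong (hK : IsCompact K) {x y : EuclideanSpace ℝ (Fin d)}
    (hx : x ∈ K) (hy : y ∈ K) : ⟪u, x - y⟫ ≤ widthAlong K u := by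
  have hc : IsCompact ((fun x => ⟪u, x⟫) '' K) := hK.image (by fun_prop)
  have h1 := le_csSup hc.bddAbove (Set.mem_image_of_mem _ hx)
  have h2 := csInf_le hc.bddBelow (Set.mem_image_of_mem _ hy)
  rw [inner_sub_right, widthAlong]
  exact sub_le_sub h1 h2

lemma exists_inner_sub_eq_widthAlong (hK : IsCompact K) (hne : K.Nonempty)
    (u : EuclideanSpace ℝ (Fin d)) : ∃ x ∈ K, ∃ y ∈ K, ⟪u, x - y⟫ = widthAlong K u := by
  have hc : IsCompact ((fun x => ⟪u, x⟫) '' K) := hK.image (by fun_prop)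
  obtain ⟨x, hx, hx'⟩ := hc.sSup_mem (hne.image _)
  obtain ⟨y, hy, hy'⟩ := hc.sInf_mem (hne.image _)
  refine ⟨x, hx, y, hy, ?_⟩
  rw [inner_sub_right, widthAlong, ← hx', ← hy']

lemma widthAlong_nonneg (hK : IsCompact K) (hne : K.Nonempty) : 0 ≤ widthAlong K u := by
  obtain ⟨x, hx⟩ := hne
  simpa using inner_sub_le_widthAlong (u := u) hK hx hx

lemma widthAlong_add_smul (hT : IsCompact T) (hTne : T.Nonempty) (hC : IsCompact C)
    (hCne : C.Nonempty) {ρ : ℝ} (hρ : 0 ≤ ρ) :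
    widthAlong (T + ρ • C) u = widthAlong T u + ρ * widthAlong C u := by
  apply le_antisymm
  · obtain ⟨x, hx, y, hy, hxy⟩ := exists_inner_sub_eq_widthAlong (hT.add (hC.smul ρ))
      (hTne.add hCne.smul_set) u
    obtain ⟨a, ha, b, ⟨c, hc, rfl⟩, rfl⟩ := hx
    obtain ⟨a', ha', b', ⟨c', hc', rfl⟩, rfl⟩ := hy
    have h1 := inner_sub_le_widthAlong (u := u) hT ha ha'
    have h2 := mul_le_mul_of_nonneg_left (inner_sub_le_widthAlong (u := u) hC hc hc') hρ
    rw [← hxy]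
    simp only [inner_sub_right, inner_add_right, inner_smul_right] at *
    linarith
  · obtain ⟨x, hx, y, hy, hxy⟩ := exists_inner_sub_eq_widthAlong hT hTne u
    obtain ⟨c, hc, c', hc', hcc⟩ := exists_inner_sub_eq_widthAlong hC hCne u
    have := inner_sub_le_widthAlong (u := u) (hT.add (hC.smul ρ))
      (Set.add_mem_add hx (Set.smul_mem_smul_set hc)) (Set.add_mem_add hy (Set.smul_mem_smul_set hc'))
    rw [← hxy, ← hcc]
    simp only [inner_sub_right, inner_add_right, inner_smul_right] at *
    linarith

lemma widthAlong_pos_of_interior (hK : IsCompact K) (hint : (interior K).Nonempty) (hu : ‖u‖ = 1) :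
    0 < widthAlong K u := by
  obtain ⟨p, hp⟩ := hint
  obtain ⟨ε, hε, hb⟩ := Metric.mem_nhds_iff.1 (mem_interior_iff_mem_nhds.1 hp)
  have hq : p + (ε / 2) • u ∈ K := hb (by
    simp [norm_smul, hu, abs_of_pos hε]; linarith)
  have := inner_sub_le_widthAlong (u := u) hK hq (interior_subset hp)
  rw [add_sub_cancel_left, inner_smul_right, real_inner_self_eq_norm_sq, hu] at this
  linarith

/-- A convex set with empty interior has a proper affine span, and its width vanishes along any
normal to that span. -/
lemma interior_nonempty_of_widthAlong_pos (hT : IsCompact T) (hconv : Convex ℝ T)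
    (hne : T.Nonempty) (h : ∀ u, ‖u‖ = 1 → 0 < widthAlong T u) : (interior T).Nonempty := by
  rw [hconv.interior_nonempty_iff_affineSpan_eq_top,
    ← AffineSubspace.direction_eq_top_iff_of_nonempty (hne.affineSpan ℝ), direction_affineSpan,
    ← Submodule.orthogonal_eq_bot_iff, Submodule.eq_bot_iff]
  intro v hv
  by_contra hv0
  have hn : 0 < ‖v‖ := norm_pos_iff.2 hv0
  have hu : ‖(‖v‖⁻¹ • v)‖ = 1 := by
    rw [norm_smul, norm_inv, norm_norm, inv_mul_cancel₀ hn.ne']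
  obtain ⟨x, hx, y, hy, hxy⟩ := exists_inner_sub_eq_widthAlong hT hne (‖v‖⁻¹ • v)
  have := h _ hu
  have h0 := Submodule.inner_left_of_mem_orthogonal (vsub_mem_vectorSpan ℝ hx hy) hv
  rw [vsub_eq_sub] at h0
  rw [← hxy, inner_smul_left, h0] at this
  simp at this

end Support

/-! ### Erosions and admissible factors -/

section Erosion

variable {d : ℕ} {K L L₀ L₁ C : Set (EuclideanSpace ℝ (Fin d))} {m : ℕ}

lemma vadd_smul_subset_iff {ρ : ℝ} {t : EuclideanSpace ℝ (Fin d)} :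
    t +ᵥ ρ • C ⊆ L ↔ t ∈ erosion C L ρ := by
  constructor
  · intro h c hc
    exact h ⟨_, Set.smul_mem_smul_set hc, rfl⟩
  · rintro h _ ⟨_, ⟨c, hc, rfl⟩, rfl⟩
    exact h c hc

lemma roundedBody_eq (ρ : ℝ) : roundedBody C L ρ = erosion C L ρ + ρ • C := by
  ext x
  simp only [roundedBody, Set.mem_iUnion, exists_prop, vadd_smul_subset_iff]
  constructor
  · rintro ⟨t, ht, b, hb, rfl⟩
    exact Set.add_mem_add ht hb
  · rintro ⟨t, ht, b, hb, rfl⟩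
    exact ⟨t, ht, b, hb, rfl⟩

lemma erosion_mono {ρ : ℝ} (h : K ⊆ L) : erosion C K ρ ⊆ erosion C L ρ :=
  fun _ hx c hc => h (hx c hc)

/-- The source of all concavity below: translates of `ρ • C` in `L₀` and of `σ • C` in `L₁` combine
pointwise, using the same `c` in both. -/
lemma mem_erosion_combo {a b ρ σ : ℝ} (hL : a • L₀ + b • L₁ ⊆ L)
    {x y : EuclideanSpace ℝ (Fin d)} (hx : x ∈ erosion C L₀ ρ) (hy : y ∈ erosion C L₁ σ) :
    a • x + b • y ∈ erosion C L (a * ρ + b * σ) := by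
  intro c hc
  have := hL (Set.add_mem_add (Set.smul_mem_smul_set (a := a) (hx c hc))
    (Set.smul_mem_smul_set (a := b) (hy c hc)))
  convert this using 1
  module

lemma erosion_zero (hC : C.Nonempty) : erosion C L 0 = L := by
  obtain ⟨c, hc⟩ := hC
  ext x
  refine ⟨fun h => by simpa using h c hc, fun h c _ => by simpa using h⟩

lemma convex_combo_subset (hL : Convex ℝ L) {a b : ℝ} (ha : 0 ≤ a) (hb : 0 ≤ b) (hab : a + b = 1) :
    a • L + b • L ⊆ L := by
  rintro _ ⟨_, ⟨x, hx, rfl⟩, _, ⟨y, hy, rfl⟩, rfl⟩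
  exact hL hx hy ha hb hab

lemma convex_erosion (hL : Convex ℝ L) (ρ : ℝ) : Convex ℝ (erosion C L ρ) := by
  intro x hx y hy a b ha hb hab
  have := mem_erosion_combo (convex_combo_subset hL ha hb hab) hx hy
  rwa [← add_mul, hab, one_mul] at this

lemma isCompact_erosion (hL : IsCompact L) (hC : C.Nonempty) (ρ : ℝ) :
    IsCompact (erosion C L ρ) := by
  have hcl : IsClosed (erosion C L ρ) := by
    have : erosion C L ρ = ⋂ c ∈ C, (fun x => x + ρ • c) ⁻¹' L := by
      ext; simp [erosion]
    rw [this]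
    exact isClosed_biInter fun c _ => hL.isClosed.preimage (by fun_prop)
  obtain ⟨c, hc⟩ := hC
  refine (hL.image (f := fun x => x - ρ • c) (by fun_prop)).of_isClosed_subset hcl ?_
  intro x hx
  exact ⟨_, hx c hc, by simp⟩

lemma admissibleFactors_mono (h : K ⊆ L) : admissibleFactors C K m ⊆ admissibleFactors C L m := by
  rintro ρ ⟨h0, hρ⟩
  refine ⟨h0, fun u hu => ?_⟩
  obtain ⟨x, hx, y, hy, hxy⟩ := hρ u hu
  exact ⟨x, erosion_mono h hx, y, erosion_mono h hy, hxy⟩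

lemma admissibleFactors_combo {a b ρ σ : ℝ} (ha : 0 ≤ a) (hb : 0 ≤ b)
    (hL : a • L₀ + b • L₁ ⊆ L) (hρ : ρ ∈ admissibleFactors C L₀ m)
    (hσ : σ ∈ admissibleFactors C L₁ m) : a * ρ + b * σ ∈ admissibleFactors C L m := by
  refine ⟨add_nonneg (mul_nonneg ha hρ.1) (mul_nonneg hb hσ.1), fun u hu => ?_⟩
  obtain ⟨x, hx, y, hy, hxy⟩ := hρ.2 u hu
  obtain ⟨x', hx', y', hy', hxy'⟩ := hσ.2 u hu
  refine ⟨_, mem_erosion_combo hL hx hx', _, mem_erosion_combo hL hy hy', ?_⟩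
  have h1 := mul_le_mul_of_nonneg_left hxy ha
  have h2 := mul_le_mul_of_nonneg_left hxy' hb
  simp only [inner_sub_right, inner_add_right, inner_smul_right] at *
  linarith

lemma admissibleFactors_subset_vadd (v : EuclideanSpace ℝ (Fin d)) :
    admissibleFactors C L m ⊆ admissibleFactors C (v +ᵥ L) m := by
  rintro ρ ⟨h0, hρ⟩
  have key : ∀ x ∈ erosion C L ρ, v + x ∈ erosion C (v +ᵥ L) ρ := fun x hx c hc =>
    ⟨_, hx c hc, by simp [add_assoc]⟩
  refine ⟨h0, fun u hu => ?_⟩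
  obtain ⟨x, hx, y, hy, hxy⟩ := hρ u hu
  exact ⟨_, key x hx, _, key y hy, by simpa using hxy⟩

lemma zero_mem_admissibleFactors (hC : C.Nonempty) (hL : L.Nonempty) :
    0 ∈ admissibleFactors C L m := by
  obtain ⟨x, hx⟩ := hL
  refine ⟨le_rfl, fun u _ => ?_⟩
  rw [erosion_zero hC]
  exact ⟨x, hx, x, hx, by simp⟩

lemma exists_norm_eq_one (hd : 0 < d) : ∃ u : EuclideanSpace ℝ (Fin d), ‖u‖ = 1 :=
  ⟨EuclideanSpace.single ⟨0, hd⟩ 1, by simp⟩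

lemma mul_widthAlong_le_of_mem_erosion (hL : IsCompact L) (hC : IsCompact C) (hCne : C.Nonempty)
    {ρ : ℝ} {u x : EuclideanSpace ℝ (Fin d)} (hx : x ∈ erosion C L ρ) :
    ρ * widthAlong C u ≤ widthAlong L u := by
  obtain ⟨c, hc, c', hc', hcc⟩ := exists_inner_sub_eq_widthAlong hC hCne u
  have := inner_sub_le_widthAlong (u := u) hL (hx c hc) (hx c' hc')
  rwa [add_sub_add_left_eq_sub, ← smul_sub, inner_smul_right, hcc] at this

lemma exists_forall_erosion_le (hd : 0 < d) (hC : IsConvexBody C) (hL : IsCompact L) :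
    ∃ M : ℝ, ∀ ρ, (erosion C L ρ).Nonempty → ρ ≤ M := by
  obtain ⟨u, hu⟩ := exists_norm_eq_one hd
  refine ⟨widthAlong L u / widthAlong C u, fun ρ ⟨x, hx⟩ => ?_⟩
  rw [le_div_iff₀ (widthAlong_pos_of_interior hC.isCompact hC.interior_nonempty hu)]
  exact mul_widthAlong_le_of_mem_erosion hL hC.isCompact
    (hC.interior_nonempty.mono interior_subset) hx

lemma erosion_nonempty_of_mem (hd : 0 < d) {ρ : ℝ} (hρ : ρ ∈ admissibleFactors C L m) :
    (erosion C L ρ).Nonempty := by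
  obtain ⟨u, hu⟩ := exists_norm_eq_one hd
  obtain ⟨x, hx, -⟩ := hρ.2 u hu
  exact ⟨x, hx⟩

lemma bddAbove_admissibleFactors (hd : 0 < d) (hC : IsConvexBody C) (hL : IsCompact L) :
    BddAbove (admissibleFactors C L m) := by
  obtain ⟨M, hM⟩ := exists_forall_erosion_le hd hC hL
  exact ⟨M, fun ρ hρ => hM ρ (erosion_nonempty_of_mem hd hρ)⟩

lemma isCompact_admissibleFactors (hd : 0 < d) (hC : IsConvexBody C) (hL : IsCompact L) :
    IsCompact (admissibleFactors C L m) := by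
  have hCne := hC.interior_nonempty.mono interior_subset
  obtain ⟨M, hM⟩ := exists_forall_erosion_le hd hC hL
  obtain ⟨c, hc⟩ := hCne
  let G : Set (ℝ × EuclideanSpace ℝ (Fin d)) := {p | 0 ≤ p.1 ∧ p.2 ∈ erosion C L p.1}
  have hGc : IsClosed G := by
    have : G = {p | 0 ≤ p.1} ∩ ⋂ c ∈ C, (fun p => p.2 + p.1 • c) ⁻¹' L := by
      ext; simp [erosion, G]
    rw [this]
    exact (isClosed_le (by fun_prop) (by fun_prop)).inter
      (isClosed_biInter fun c _ => hL.isClosed.preimage (by fun_prop))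
  have hG : IsCompact G := by
    refine ((isCompact_Icc (a := (0 : ℝ)) (b := M)).prod hL |>.image
      (f := fun p => (p.1, p.2 - p.1 • c)) (by fun_prop)).of_isClosed_subset hGc ?_
    rintro ⟨ρ, x⟩ ⟨h0, hx⟩
    exact ⟨(ρ, x + ρ • c), ⟨⟨h0, hM ρ ⟨x, hx⟩⟩, hx c hc⟩, by simp⟩
  -- For a fixed direction the admissible `ρ` are the projection of a compact set of pairs from `G`
  -- with a common factor; intersecting over directions preserves closedness.
  have key : ∀ u : EuclideanSpace ℝ (Fin d), IsCompact {ρ : ℝ | 0 ≤ ρ ∧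
      ∃ x ∈ erosion C L ρ, ∃ y ∈ erosion C L ρ,
        (m - 1 : ℝ) * ρ * widthAlong C u ≤ ⟪u, x - y⟫} := by
    intro u
    have hcl : IsClosed {q : (ℝ × EuclideanSpace ℝ (Fin d)) × (ℝ × EuclideanSpace ℝ (Fin d)) |
        q.1.1 = q.2.1 ∧ (m - 1 : ℝ) * q.1.1 * widthAlong C u ≤ ⟪u, q.1.2 - q.2.2⟫} := by
      rw [Set.ofPred_and]
      exact (isClosed_eq (by fun_prop) (by fun_prop)).inter
        (isClosed_le (by fun_prop) (by fun_prop))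
    convert ((hG.prod hG).inter_right hcl).image (f := fun q => q.1.1) (by fun_prop) using 1
    ext ρ
    constructor
    · rintro ⟨h0, x, hx, y, hy, h⟩
      exact ⟨((ρ, x), (ρ, y)), ⟨⟨⟨h0, hx⟩, ⟨h0, hy⟩⟩, rfl, h⟩, rfl⟩
    · rintro ⟨⟨⟨ρ, x⟩, ⟨σ, y⟩⟩, ⟨⟨⟨h0, hx⟩, ⟨-, hy⟩⟩, h1, h⟩, rfl⟩
      obtain rfl : ρ = σ := h1
      exact ⟨h0, x, hx, y, hy, h⟩
  obtain ⟨u₀, hu₀⟩ := exists_norm_eq_one hd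
  refine (key u₀).of_isClosed_subset ?_ fun ρ hρ => ⟨hρ.1, hρ.2 u₀ hu₀⟩
  have : admissibleFactors C L m = ⋂ (u : EuclideanSpace ℝ (Fin d)) (_ : ‖u‖ = 1), {ρ : ℝ | 0 ≤ ρ ∧
      ∃ x ∈ erosion C L ρ, ∃ y ∈ erosion C L ρ,
        (m - 1 : ℝ) * ρ * widthAlong C u ≤ ⟪u, x - y⟫} := by
    ext ρ
    simp only [Set.mem_iInter]
    exact ⟨fun h u hu => ⟨h.1, h.2 u hu⟩, fun h => ⟨(h u₀ hu₀).1, fun u hu => (h u hu).2⟩⟩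
  rw [this]
  exact isClosed_iInter fun u => isClosed_iInter fun _ => (key u).isClosed

lemma exists_pos_mem_admissibleFactors (hC : IsConvexBody C) (hL : IsConvexBody L) (hm : 1 ≤ m) :
    ∃ ρ > 0, ρ ∈ admissibleFactors C L m := by
  obtain ⟨p, hp⟩ := hL.interior_nonempty
  obtain ⟨ε, hε, hb⟩ := Metric.mem_nhds_iff.1 (mem_interior_iff_mem_nhds.1 hp)
  obtain ⟨M, hM0, hM⟩ := hC.isCompact.isBounded.exists_pos_norm_le
  have hCne := hC.interior_nonempty.mono interior_subset
  have hm' : (1 : ℝ) ≤ m := by exact_mod_cast hm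
  have hm0 : (0 : ℝ) < m := by linarith
  -- With this `ρ`, the set `ρ • C` has norm at most `ε / 4`, so the vectors `p ± (ε / 4) • u` both
  -- lie in the erosion. Their separation `ε / 2 = m * ρ * (2 * M)` exceeds what is required,
  -- because the width of `C` is at most `2 * M`.
  have hρ : 0 < ε / (4 * m * M) := by positivity
  set ρ := ε / (4 * m * M) with hρdef
  have hρM : ρ * M * m = ε / 4 := by rw [hρdef]; field_simp
  have hρM' : ρ * M ≤ ε / 4 := by
    have : 0 < ρ * M := by positivity
    nlinarith
  have hmem : ∀ z : EuclideanSpace ℝ (Fin d), ‖z‖ ≤ ε / 4 → p + z ∈ erosion C L ρ := by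
    intro z hz c hc
    apply hb
    rw [Metric.mem_ball, dist_eq_norm]
    have h1 : ‖ρ • c‖ ≤ ρ * M := by
      rw [norm_smul, Real.norm_of_nonneg hρ.le]
      exact mul_le_mul_of_nonneg_left (hM c hc) hρ.le
    calc ‖p + z + ρ • c - p‖ = ‖z + ρ • c‖ := by congr 1; abel
      _ ≤ ‖z‖ + ‖ρ • c‖ := norm_add_le _ _
      _ < ε := by linarith
  refine ⟨ρ, hρ, hρ.le, fun u hu => ?_⟩
  have hn : ‖(ε / 4) • u‖ = ε / 4 := by
    rw [norm_smul, hu, mul_one, Real.norm_of_nonneg (by positivity)]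
  refine ⟨_, hmem ((ε / 4) • u) hn.le, _, hmem (-((ε / 4) • u)) (by rw [norm_neg, hn]), ?_⟩
  have hw : widthAlong C u ≤ 2 * M := by
    obtain ⟨x, hx, y, hy, hxy⟩ := exists_inner_sub_eq_widthAlong hC.isCompact hCne u
    rw [← hxy]
    calc ⟪u, x - y⟫ ≤ ‖u‖ * ‖x - y‖ := real_inner_le_norm _ _
      _ ≤ ‖x‖ + ‖y‖ := by rw [hu, one_mul]; exact norm_sub_le _ _
      _ ≤ 2 * M := by linarith [hM x hx, hM y hy]
  have : p + (ε / 4) • u - (p + -((ε / 4) • u)) = (ε / 2) • u := by module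
  rw [this, inner_smul_right, real_inner_self_eq_norm_sq, hu]
  have : (m - 1 : ℝ) * ρ * widthAlong C u ≤ (m - 1) * ρ * (2 * M) :=
    mul_le_mul_of_nonneg_left hw (mul_nonneg (by linarith) hρ.le)
  nlinarith [mul_pos hρ hM0]

end Erosion

/-- The largest admissible factor. -/
noncomputable def maxFactor {d : ℕ} (C L : Set (EuclideanSpace ℝ (Fin d))) (m : ℕ) : ℝ :=
  sSup (admissibleFactors C L m)

/-! ### The largest admissible factor is the successive inradius -/

section SuccessiveInradius

variable {d : ℕ} {C K L L₀ L₁ : Set (EuclideanSpace ℝ (Fin d))} {m : ℕ}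

lemma IsConvexBody.nonempty (hC : IsConvexBody C) : C.Nonempty :=
  hC.interior_nonempty.mono interior_subset

lemma IsConvexBody.widthAlong_pos (hC : IsConvexBody C) {u : EuclideanSpace ℝ (Fin d)}
    (hu : ‖u‖ = 1) : 0 < widthAlong C u :=
  widthAlong_pos_of_interior hC.isCompact hC.interior_nonempty hu

lemma IsConvexBody.vadd (hK : IsConvexBody K) (v : EuclideanSpace ℝ (Fin d)) :
    IsConvexBody (v +ᵥ K) :=
  ⟨hK.convex.vadd v, hK.isCompact.vadd v, by
    rw [interior_vadd]; exact hK.interior_nonempty.vadd_set⟩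

lemma maxFactor_nonneg : 0 ≤ maxFactor C L m := Real.sSup_nonneg fun _ h => h.1

lemma maxFactor_mem (hd : 0 < d) (hC : IsConvexBody C) (hL : IsCompact L) (hne : L.Nonempty) :
    maxFactor C L m ∈ admissibleFactors C L m :=
  (isCompact_admissibleFactors hd hC hL).sSup_mem ⟨0, zero_mem_admissibleFactors hC.nonempty hne⟩

lemma le_maxFactor (hd : 0 < d) (hC : IsConvexBody C) (hL : IsCompact L) {ρ : ℝ}
    (hρ : ρ ∈ admissibleFactors C L m) : ρ ≤ maxFactor C L m :=
  le_csSup (bddAbove_admissibleFactors hd hC hL) hρ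

lemma maxFactor_pos (hd : 0 < d) (hC : IsConvexBody C) (hL : IsConvexBody L) (hm : 1 ≤ m) :
    0 < maxFactor C L m := by
  obtain ⟨ρ, h0, hρ⟩ := exists_pos_mem_admissibleFactors hC hL hm
  exact h0.trans_le (le_maxFactor hd hC hL.isCompact hρ)

lemma maxFactor_mono (hd : 0 < d) (hC : IsConvexBody C) (hL : IsCompact L) (h : K ⊆ L) :
    maxFactor C K m ≤ maxFactor C L m :=
  Real.sSup_le (fun _ hρ => le_maxFactor hd hC hL (admissibleFactors_mono h hρ)) maxFactor_nonneg

lemma maxFactor_combo (hd : 0 < d) (hC : IsConvexBody C) (h₀ : IsCompact L₀) (hne₀ : L₀.Nonempty)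
    (h₁ : IsCompact L₁) (hne₁ : L₁.Nonempty) (hL : IsCompact L) {a b : ℝ} (ha : 0 ≤ a)
    (hb : 0 ≤ b) (h : a • L₀ + b • L₁ ⊆ L) :
    a * maxFactor C L₀ m + b * maxFactor C L₁ m ≤ maxFactor C L m :=
  le_maxFactor hd hC hL
    (admissibleFactors_combo ha hb h (maxFactor_mem hd hC h₀ hne₀) (maxFactor_mem hd hC h₁ hne₁))

lemma maxFactor_vadd (v : EuclideanSpace ℝ (Fin d)) :
    maxFactor C (v +ᵥ L) m = maxFactor C L m := by
  unfold maxFactor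
  congr 1
  refine Set.Subset.antisymm ?_ (admissibleFactors_subset_vadd v)
  simpa using admissibleFactors_subset_vadd (C := C) (L := v +ᵥ L) (m := m) (-v)

lemma maxFactor_eq_zero (hd : 0 < d) (hC : IsConvexBody C) (h : interior L = ∅) :
    maxFactor C L m = 0 := by
  refine le_antisymm (Real.sSup_nonpos fun ρ hρ => ?_) maxFactor_nonneg
  by_contra! h0
  obtain ⟨x, hx⟩ := erosion_nonempty_of_mem hd hρ
  have hsub : x +ᵥ ρ • interior C ⊆ L :=
    (Set.vadd_set_mono (Set.smul_set_mono interior_subset)).trans (vadd_smul_subset_iff.2 hx)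
  have hopen : IsOpen (x +ᵥ ρ • interior C) := (isOpen_interior.smul₀ h0.ne').vadd x
  have := (hC.interior_nonempty.smul_set (a := ρ)).vadd_set (a := x) |>.mono
    (interior_maximal hsub hopen)
  simp [h] at this

lemma widthAlong_roundedBody (hC : IsConvexBody C) (hL : IsCompact L) {ρ : ℝ} (hρ : 0 ≤ ρ)
    (hne : (erosion C L ρ).Nonempty) (u : EuclideanSpace ℝ (Fin d)) :
    widthAlong (roundedBody C L ρ) u = widthAlong (erosion C L ρ) u + ρ * widthAlong C u := by
  rw [roundedBody_eq, widthAlong_add_smul (isCompact_erosion hL hC.nonempty ρ) hne hC.isCompact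
    hC.nonempty hρ]

/-- Width is additive under Minkowski sums, so the summand `ρ • C` of the rounded body adds exactly
`ρ` to each relative width. -/
lemma le_minRelWidth_roundedBody_iff (hd : 0 < d) (hC : IsConvexBody C) (hL : IsCompact L)
    {ρ : ℝ} (hρ : 0 ≤ ρ) (hne : (erosion C L ρ).Nonempty) (s : ℝ) :
    s + ρ ≤ minRelWidth C (roundedBody C L ρ) ↔
      ∀ u, ‖u‖ = 1 → s * widthAlong C u ≤ widthAlong (erosion C L ρ) u := by
  obtain ⟨u₀, hu₀⟩ := exists_norm_eq_one hd
  have : Nonempty (Metric.sphere (0 : EuclideanSpace ℝ (Fin d)) 1) := ⟨⟨u₀, by simpa using hu₀⟩⟩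
  have hval : ∀ u, ‖u‖ = 1 → widthAlong (roundedBody C L ρ) u / widthAlong C u =
      widthAlong (erosion C L ρ) u / widthAlong C u + ρ := by
    intro u hu
    have := (hC.widthAlong_pos hu).ne'
    rw [widthAlong_roundedBody hC hL hρ hne]
    field_simp
  have hbdd : BddBelow (Set.range fun u : Metric.sphere (0 : EuclideanSpace ℝ (Fin d)) 1 =>
      widthAlong (roundedBody C L ρ) u / widthAlong C u) := by
    refine ⟨0, ?_⟩
    rintro _ ⟨⟨u, hu⟩, rfl⟩
    have hu : ‖u‖ = 1 := by simpa using hu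
    simp only [hval u hu]
    exact add_nonneg (div_nonneg
      (widthAlong_nonneg (isCompact_erosion hL hC.nonempty ρ) hne) (hC.widthAlong_pos hu).le) hρ
  rw [minRelWidth, le_ciInf_iff hbdd]
  constructor
  · intro h u hu
    have := h ⟨u, by simpa using hu⟩
    rw [hval u hu, add_le_add_iff_right, le_div_iff₀ (hC.widthAlong_pos hu)] at this
    exact this
  · rintro h ⟨u, hu⟩
    have hu : ‖u‖ = 1 := by simpa using hu
    rw [hval u hu, add_le_add_iff_right, le_div_iff₀ (hC.widthAlong_pos hu)]
    exact h u hu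

lemma mem_admissibleFactors_iff (hd : 0 < d) (hC : IsConvexBody C) (hL : IsCompact L)
    {ρ : ℝ} (hρ : 0 ≤ ρ) : ρ ∈ admissibleFactors C L m ↔ (erosion C L ρ).Nonempty ∧
      ∀ u, ‖u‖ = 1 → ((m - 1 : ℝ) * ρ) * widthAlong C u ≤ widthAlong (erosion C L ρ) u := by
  have hc := isCompact_erosion hL hC.nonempty ρ
  constructor
  · intro h
    refine ⟨erosion_nonempty_of_mem hd h, fun u hu => ?_⟩
    obtain ⟨x, hx, y, hy, hxy⟩ := h.2 u hu
    exact hxy.trans (inner_sub_le_widthAlong hc hx hy)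
  · rintro ⟨hne, h⟩
    refine ⟨hρ, fun u hu => ?_⟩
    obtain ⟨x, hx, y, hy, hxy⟩ := exists_inner_sub_eq_widthAlong hc hne u
    exact ⟨x, hx, y, hy, hxy ▸ h u hu⟩

lemma widthAlong_erosion_combo (hC : IsConvexBody C) (hL : IsCompact L) {a b ρ σ : ℝ}
    (h : a • L₀ + b • L₁ ⊆ L) (h₀ : IsCompact L₀) (h₁ : IsCompact L₁)
    (hne₀ : (erosion C L₀ ρ).Nonempty) (hne₁ : (erosion C L₁ σ).Nonempty)
    (u : EuclideanSpace ℝ (Fin d)) :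
    a * widthAlong (erosion C L₀ ρ) u + b * widthAlong (erosion C L₁ σ) u ≤
      widthAlong (erosion C L (a * ρ + b * σ)) u := by
  obtain ⟨x, hx, y, hy, hxy⟩ :=
    exists_inner_sub_eq_widthAlong (isCompact_erosion h₀ hC.nonempty ρ) hne₀ u
  obtain ⟨x', hx', y', hy', hxy'⟩ :=
    exists_inner_sub_eq_widthAlong (isCompact_erosion h₁ hC.nonempty σ) hne₁ u
  have := inner_sub_le_widthAlong (u := u) (isCompact_erosion hL hC.nonempty _)
    (mem_erosion_combo h hx hx') (mem_erosion_combo h hy hy')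
  rw [← hxy, ← hxy']
  simp only [inner_sub_right, inner_add_right, inner_smul_right] at *
  linarith

lemma isSuccessiveInradius_maxFactor (hd : 0 < d) (hC : IsConvexBody C) (hL : IsConvexBody L)
    (hm : 1 ≤ m) : IsSuccessiveInradius C L m (maxFactor C L m) := by
  have hpos := maxFactor_pos hd hC hL hm
  have hmem := maxFactor_mem (m := m) hd hC hL.isCompact hL.nonempty
  have hm' : (1 : ℝ) ≤ m := by exact_mod_cast hm
  set R := maxFactor C L m with hR
  obtain ⟨hne, hw⟩ := (mem_admissibleFactors_iff hd hC hL.isCompact hpos.le).1 hmem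
  refine ⟨hpos, ?_, ?_⟩
  · obtain ⟨M, hM⟩ := exists_forall_erosion_le hd hC hL.isCompact
    simp only [relInradius, vadd_smul_subset_iff]
    exact le_csSup ⟨M, fun ρ hρ => hM ρ hρ.2⟩ ⟨hpos, hne⟩
  have hiff := le_minRelWidth_roundedBody_iff hd hC hL.isCompact hpos.le hne
  refine le_antisymm ?_ ?_
  · by_contra! hlt
    have hT := isCompact_erosion hL.isCompact hC.nonempty R
    set W := minRelWidth C (roundedBody C L R)
    have hW := (hiff (W - R)).1 (by linarith)
    have hint := interior_nonempty_of_widthAlong_pos hT (convex_erosion hL.convex R) hne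
      (fun u hu => (mul_pos (by nlinarith) (hC.widthAlong_pos hu)).trans_le (hW u hu))
    -- If the width exceeded `m * R`, the erosion would have interior and so would contain a
    -- translate of some `s • C`. Hence `L` contains a translate of `(R + s) • C`, and there is room
    -- to enlarge `R`.
    obtain ⟨s, hs0, hs⟩ := exists_pos_mem_admissibleFactors (m := 1) hC
      ⟨convex_erosion hL.convex R, hT, hint⟩ le_rfl
    obtain ⟨z, hz⟩ := erosion_nonempty_of_mem hd hs
    have hz' : z ∈ erosion C L (R + s) := by
      intro c hc
      have := hz c hc c hc
      convert this using 1
      module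
    have hR' : 0 < R + s := by linarith
    -- The witness solves the last inequality with equality.
    obtain ⟨t, ht0, ht1, ht⟩ : ∃ t : ℝ, 0 < t ∧ t ≤ 1 ∧
        (m - 1) * ((1 - t) * R + t * (R + s)) ≤ (1 - t) * (W - R) := by
      have hden : 0 < (m - 1) * s + (W - R) := by nlinarith
      refine ⟨(W - m * R) / ((m - 1) * s + (W - R)), div_pos (by linarith) hden, ?_, ?_⟩
      · rw [div_le_one hden]; nlinarith
      · have : (W - m * R) / ((m - 1) * s + (W - R)) * ((m - 1) * s + (W - R)) = W - m * R :=
          div_mul_cancel₀ _ hden.ne'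
        linarith
    have hconv := convex_combo_subset hL.convex (by linarith : 0 ≤ 1 - t) ht0.le (by ring)
    have hmem' : (1 - t) * R + t * (R + s) ∈ admissibleFactors C L m := by
      refine (mem_admissibleFactors_iff hd hC hL.isCompact (by nlinarith)).2 ⟨?_, fun u hu => ?_⟩
      · obtain ⟨x, hx⟩ := hne
        exact ⟨_, mem_erosion_combo hconv hx hz'⟩
      · have h1 := widthAlong_erosion_combo hC hL.isCompact hconv
          hL.isCompact hL.isCompact hne ⟨z, hz'⟩ u
        have h2 := widthAlong_nonneg (u := u) (isCompact_erosion hL.isCompact hC.nonempty (R + s))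
          ⟨z, hz'⟩
        have h3 := mul_le_mul_of_nonneg_left (hW u hu) (by linarith : 0 ≤ 1 - t)
        have h4 := mul_le_mul_of_nonneg_right ht (hC.widthAlong_pos hu).le
        nlinarith [mul_nonneg ht0.le h2]
    have := le_maxFactor hd hC hL.isCompact hmem'
    nlinarith [mul_pos ht0 hs0]
  · have := (hiff ((m - 1) * R)).2 hw
    linarith

lemma IsSuccessiveInradius.eq_maxFactor (hd : 0 < d) (hC : IsConvexBody C) (hL : IsConvexBody L)
    (hm : 1 ≤ m) {ρ : ℝ} (h : IsSuccessiveInradius C L m ρ) : ρ = maxFactor C L m := by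
  have hpos := maxFactor_pos hd hC hL hm
  have hmem := maxFactor_mem (m := m) hd hC hL.isCompact hL.nonempty
  have hm' : (1 : ℝ) ≤ m := by exact_mod_cast hm
  obtain ⟨hρ, -, heq⟩ := h
  -- An empty rounded body would have width `0` by the default values of `sSup` and `sInf`, but `m *
  -- ρ > 0`.
  have hne : (erosion C L ρ).Nonempty := by
    by_contra hne
    rw [Set.not_nonempty_iff_eq_empty] at hne
    rw [roundedBody_eq, hne] at heq
    simp only [minRelWidth, widthAlong, Set.empty_add, Set.image_empty, Real.sSup_empty,
      Real.sInf_empty, sub_self, zero_div, Real.iInf_const_zero] at heq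
    nlinarith
  have hiff := le_minRelWidth_roundedBody_iff hd hC hL.isCompact hρ.le hne
  have hmem' : ρ ∈ admissibleFactors C L m :=
    (mem_admissibleFactors_iff hd hC hL.isCompact hρ.le).2
      ⟨hne, (hiff ((m - 1) * ρ)).1 (by rw [heq]; linarith)⟩
  refine le_antisymm (le_maxFactor hd hC hL.isCompact hmem') ?_
  by_contra! hlt
  set R := maxFactor C L m
  obtain ⟨hne', hw⟩ := (mem_admissibleFactors_iff hd hC hL.isCompact hpos.le).1 hmem
  -- For `ρ < R`, interpolate between the erosion at `R` and the erosion at `0`, which is `L`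
  -- itself. As `L` has relative width at least `R`, the rounded body at `ρ` has width at least `m *
  -- ρ + (1 - t) * R`, which is too large.
  obtain ⟨t, ht0, ht1, rfl⟩ : ∃ t : ℝ, 0 < t ∧ t < 1 ∧ t * R + (1 - t) * 0 = ρ :=
    ⟨ρ / R, by positivity, (div_lt_one hpos).2 hlt, by field_simp; ring⟩
  have hz : erosion C L 0 = L := erosion_zero hC.nonempty
  have := (hiff ((m - 1) * (t * R + (1 - t) * 0) + (1 - t) * R)).2 (fun u hu => by
    have h1 := widthAlong_erosion_combo hC hL.isCompact
      (convex_combo_subset hL.convex ht0.le (by linarith : 0 ≤ 1 - t) (by ring))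
      hL.isCompact hL.isCompact hne' (σ := 0) (by rw [hz]; exact hL.nonempty) u
    rw [hz] at h1
    obtain ⟨z, hz⟩ := hne'
    have h2 := mul_le_mul_of_nonneg_left
      (mul_widthAlong_le_of_mem_erosion (u := u) hL.isCompact hC.isCompact hC.nonempty hz)
      (by linarith : 0 ≤ 1 - t)
    have h3 := mul_le_mul_of_nonneg_left (hw u hu) ht0.le
    refine le_trans (le_of_eq ?_) ((add_le_add h3 h2).trans h1)
    ring)
  rw [heq] at this
  nlinarith [mul_pos (by linarith : 0 < 1 - t) hpos]

lemma existsUnique_isSuccessiveInradius (hd : 0 < d) (hC : IsConvexBody C) (hL : IsConvexBody L)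
    (hm : 1 ≤ m) : ∃! ρ : ℝ, IsSuccessiveInradius C L m ρ :=
  ⟨_, isSuccessiveInradius_maxFactor hd hC hL hm, fun _ h => h.eq_maxFactor hd hC hL hm⟩

lemma successiveInradius_eq_maxFactor (hd : 0 < d) (hC : IsConvexBody C) (hL : IsConvexBody L)
    (hm : 1 ≤ m) : successiveInradius C L m = maxFactor C L m :=
  IsSuccessiveInradius.eq_maxFactor hd hC hL hm
    (Classical.epsilon_spec ⟨_, isSuccessiveInradius_maxFactor hd hC hL hm⟩)

end SuccessiveInradius

/-! ### Inductive partitions and the sliding argument -/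

section Partition

variable {d : ℕ} {C K : Set (EuclideanSpace ℝ (Fin d))} {m n : ℕ}

lemma IsInductivePartition.isClosed_and_convex {V : Fin n → Set (EuclideanSpace ℝ (Fin d))}
    (hV : IsInductivePartition n V) (i : Fin n) : IsClosed (V i) ∧ Convex ℝ (V i) := by
  match n, V, hV, i with
  | 1, V, hV, i =>
    have hV : V 0 = Set.univ := hV
    rw [Subsingleton.elim i 0, hV]
    exact ⟨isClosed_univ, convex_univ⟩
  | n + 2, V, hV, i => exact ⟨hV.1.isClosed i, hV.1.convex i⟩

lemma IsInductivePartition.disjoint_interior {V : Fin n → Set (EuclideanSpace ℝ (Fin d))}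
    (hV : IsInductivePartition n V) {i j : Fin n} (hij : i ≠ j) :
    Disjoint (interior (V i)) (interior (V j)) := by
  match n, V, hV, i, j with
  | 1, V, hV, i, j => exact absurd (Subsingleton.elim i j) hij
  | n + 2, V, hV, i, j => exact hV.1.disjoint_interior i j hij

/-- Inside the interior of `W j ∩ K`, the parts `V (i.succAbove l)` with `l ≠ j` cannot appear, as
they lie in other `W l`. Whatever `V (i.succAbove j)` misses is therefore an open subset of `V i ∩
K`, hence empty. -/
lemma subset_of_interior_eq_empty {V : Fin (n + 1) → Set (EuclideanSpace ℝ (Fin d))}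
    (hV : IsConvexPartition V) {i : Fin (n + 1)} (hi : interior (V i ∩ K) = ∅)
    {W : Fin n → Set (EuclideanSpace ℝ (Fin d))} (hW : IsInductivePartition n W)
    (hVW : ∀ j, V (i.succAbove j) ⊆ W j) (hK : IsConvexBody K) {j : Fin n}
    (hj : (interior (W j ∩ K)).Nonempty) : W j ∩ K ⊆ V (i.succAbove j) := by
  have hint : interior (W j ∩ K) ⊆ V (i.succAbove j) := by
    intro x hx
    by_contra hxV
    have hopen : IsOpen (interior (W j ∩ K) \ V (i.succAbove j)) :=
      isOpen_interior.sdiff (hV.isClosed _)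
    have hsub : interior (W j ∩ K) \ V (i.succAbove j) ⊆ V i ∩ K := by
      rintro y ⟨hy, hyV⟩
      refine ⟨?_, (interior_subset hy).2⟩
      obtain ⟨k, hk⟩ := Set.mem_iUnion.1 (hV.iUnion_eq.symm ▸ Set.mem_univ y)
      by_cases hki : k = i
      · exact hki ▸ hk
      obtain ⟨l, rfl⟩ := Fin.exists_succAbove_eq hki
      by_cases hlj : l = j
      · exact absurd (hlj ▸ hk) hyV
      -- A closed convex part is the closure of its interior, so a part that meets an open set meets
      -- it in an interior point.
      have hcl : y ∈ closure (interior (V (i.succAbove l))) := by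
        rw [(hV.convex _).closure_interior_eq_closure_of_nonempty_interior
          (hV.interior_nonempty _)]
        exact subset_closure hk
      obtain ⟨z, hz, hz'⟩ := mem_closure_iff.1 hcl _ isOpen_interior hy
      exact absurd (interior_mono Set.inter_subset_left hz)
        (Set.disjoint_left.1 (hW.disjoint_interior hlj) (interior_mono (hVW l) hz'))
    have := interior_maximal hsub hopen ⟨hx, hxV⟩
    simp [hi] at this
  have hconv := (hW.isClosed_and_convex j).2.inter hK.convex
  refine subset_closure.trans ?_
  rw [← hconv.closure_interior_eq_closure_of_nonempty_interior hj]
  exact closure_minimal hint (hV.isClosed _)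

lemma IsConvexPartition.exists_slide {V : Fin (n + 2) → Set (EuclideanSpace ℝ (Fin d))}
    (hV : IsConvexPartition V) (hK : IsConvexBody K)
    (h : ∀ i, (interior (V i ∩ K)).Nonempty) :
    ∃ v : EuclideanSpace ℝ (Fin d), ∃ a < (0 : ℝ), ∃ b > (0 : ℝ), ∀ t ∈ ({a, b} : Set ℝ),
      (∀ i, (V i ∩ (t • v +ᵥ K)).Nonempty) ∧ ∃ i, interior (V i ∩ (t • v +ᵥ K)) = ∅ := by
  -- Moving along `v` changes `f` at a constant rate, while keeping interior contact with both `V 0`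
  -- and `V 1` forces the translate of `K` to take values of `f` on both sides of `c`. This bounds
  -- the slide.
  obtain ⟨f, c, hf0, hf1⟩ := geometric_hahn_banach_open_open (hV.convex 0).interior isOpen_interior
    (hV.convex 1).interior isOpen_interior (hV.disjoint_interior 0 1 (by simp))
  obtain ⟨v, hv⟩ : ∃ v, 0 < f v := by
    obtain ⟨x, hx⟩ := hV.interior_nonempty 0
    obtain ⟨y, hy⟩ := hV.interior_nonempty 1
    exact ⟨y - x, by rw [map_sub]; linarith [hf0 x hx, hf1 y hy]⟩
  let G : Set ℝ := {t | ∀ i, (interior (V i ∩ (t • v +ᵥ K))).Nonempty}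
  have hG : G = ⋂ i, (fun t : ℝ => t • v) ⁻¹' (interior (V i) - interior K) := by
    ext t
    simp only [G, Set.mem_ofPred_eq, Set.mem_iInter, interior_inter, interior_vadd]
    refine forall_congr' fun i => ⟨?_, ?_⟩
    · rintro ⟨x, hx, y, hy, rfl⟩
      exact ⟨_, hx, y, hy, by simp⟩
    · rintro ⟨x, hx, y, hy, hxy⟩
      exact ⟨x, hx, y, hy, by simp only at hxy; simp [← hxy]⟩
  have hopen : IsOpen G := by
    rw [hG]
    exact isOpen_iInter_of_finite fun i => (isOpen_interior.sub_right).preimage (by fun_prop)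
  -- At the end positions a part may lose its interior but not its points, because `V i - K` is
  -- closed. Nonemptiness is needed there for concavity.
  have hne : ∀ t ∈ closure G, ∀ i, (V i ∩ (t • v +ᵥ K)).Nonempty := by
    intro t ht i
    have hcl : IsClosed ((fun t : ℝ => t • v) ⁻¹' (V i + -K)) :=
      ((hV.isClosed i).add_right_of_isCompact hK.isCompact.neg).preimage (by fun_prop)
    have hsub : G ⊆ (fun t : ℝ => t • v) ⁻¹' (V i + -K) := by
      rw [hG, ← sub_eq_add_neg]
      exact (Set.iInter_subset _ i).trans
        (Set.preimage_mono (Set.sub_subset_sub interior_subset interior_subset))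
    obtain ⟨x, hx, y, hy, hxy⟩ := closure_minimal hsub hcl ht
    exact ⟨x, hx, -y, hy, by simp only at hxy; simp [← hxy]⟩
  have h0 : (0 : ℝ) ∈ G := by simpa [G] using h
  obtain ⟨M, hM⟩ := hK.isCompact.exists_bound_of_continuousOn f.continuous.continuousOn
  have hbd : ∀ t ∈ G, |t| ≤ (|c| + M) / f v := by
    intro t ht
    have hpt : ∀ i, ∃ x ∈ interior (V i), ∃ y ∈ K, f x = t * f v + f y := by
      intro i
      obtain ⟨x, hx⟩ := ht i
      rw [interior_inter] at hx
      obtain ⟨y, hy, hxy⟩ := interior_subset hx.2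
      exact ⟨x, hx.1, y, hy, by rw [← hxy]; simp⟩
    obtain ⟨x, hx, y, hy, hxy⟩ := hpt 0
    obtain ⟨x', hx', y', hy', hxy'⟩ := hpt 1
    have h1 := hf0 x hx
    have h2 := hf1 x' hx'
    have h3 := abs_le.1 (hM y hy)
    have h4 := abs_le.1 (hM y' hy')
    rw [le_div_iff₀ hv, ← abs_of_pos hv, ← abs_mul, abs_le]
    constructor <;> linarith [le_abs_self c, neg_abs_le c]
  have hA : BddAbove G := ⟨_, fun t ht => (abs_le.1 (hbd t ht)).2⟩
  have hB : BddBelow G := ⟨_, fun t ht => (abs_le.1 (hbd t ht)).1⟩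
  have hsup : sSup G ∉ G := fun hmem => by
    obtain ⟨ε, hε, hb⟩ := Metric.isOpen_iff.1 hopen _ hmem
    have := le_csSup hA (hb (show sSup G + ε / 2 ∈ _ by
      rw [Metric.mem_ball, Real.dist_eq, add_sub_cancel_left, abs_of_pos] <;> linarith))
    linarith
  have hinf : sInf G ∉ G := fun hmem => by
    obtain ⟨ε, hε, hb⟩ := Metric.isOpen_iff.1 hopen _ hmem
    have := csInf_le hB (hb (show sInf G - ε / 2 ∈ _ by
      rw [Metric.mem_ball, Real.dist_eq, sub_sub_cancel_left, abs_neg, abs_of_pos] <;> linarith))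
    linarith
  have hG_not : ∀ t ∉ G, ∃ i, interior (V i ∩ (t • v +ᵥ K)) = ∅ := fun t ht => by
    simpa [G, Set.not_nonempty_iff_eq_empty] using ht
  refine ⟨v, sInf G, lt_of_le_of_ne (csInf_le hB h0) fun h => hinf (h ▸ h0),
    sSup G, lt_of_le_of_ne (le_csSup hA h0) fun h => hsup (h ▸ h0), ?_⟩
  rintro t (rfl | rfl)
  · exact ⟨hne _ (csInf_mem_closure ⟨0, h0⟩ hB), hG_not _ hinf⟩
  · exact ⟨hne _ (csSup_mem_closure ⟨0, h0⟩ hA), hG_not _ hsup⟩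

theorem maxFactor_le_sum (hd : 0 < d) (hC : IsConvexBody C) :
    ∀ (n : ℕ) (V : Fin n → Set (EuclideanSpace ℝ (Fin d))), IsInductivePartition n V →
      ∀ K, IsConvexBody K → maxFactor C K m ≤ ∑ i, maxFactor C (V i ∩ K) m
  | 0, _, hV, _, _ => hV.elim
  | 1, V, hV, K, _ => by
    have hV : V 0 = Set.univ := hV
    simp [hV]
  | n + 2, V, hV, K, hK => by
    have hcpt : ∀ {K}, IsConvexBody K → ∀ i, IsCompact (V i ∩ K) := fun hK i =>
      hK.isCompact.inter_left (hV.1.isClosed i)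
    have degenerate : ∀ K, IsConvexBody K → (∃ i, interior (V i ∩ K) = ∅) →
        maxFactor C K m ≤ ∑ i, maxFactor C (V i ∩ K) m := by
      rintro K hK ⟨i, hi⟩
      obtain ⟨W, hW, hVW⟩ := hV.2 i
      rw [Fin.sum_univ_succAbove _ i]
      refine (maxFactor_le_sum hd hC (n + 1) W hW K hK).trans
        (le_add_of_nonneg_of_le maxFactor_nonneg (Finset.sum_le_sum fun j _ => ?_))
      -- A piece `W j ∩ K` with empty interior need not lie in the corresponding part, but it
      -- contributes `0`.
      by_cases hj : (interior (W j ∩ K)).Nonempty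
      · exact maxFactor_mono hd hC (hcpt hK _) (Set.subset_inter
          (subset_of_interior_eq_empty hV.1 hi hW hVW hK hj) Set.inter_subset_right)
      · rw [maxFactor_eq_zero hd hC (Set.not_nonempty_iff_eq_empty.1 hj)]
        exact maxFactor_nonneg
    by_cases hdeg : ∃ i, interior (V i ∩ K) = ∅
    · exact degenerate K hK hdeg
    simp only [not_exists, ← Set.nonempty_iff_ne_empty] at hdeg
    obtain ⟨v, a, ha, b, hb, hab⟩ := hV.1.exists_slide hK hdeg
    obtain ⟨hane, hadeg⟩ := hab a (by simp)
    obtain ⟨hbne, hbdeg⟩ := hab b (by simp)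
    have hKa := hK.vadd (a • v)
    have hKb := hK.vadd (b • v)
    have h1 := degenerate _ hKa hadeg
    have h2 := degenerate _ hKb hbdeg
    rw [maxFactor_vadd] at h1 h2
    have hden : 0 < b - a := by linarith
    -- These weights average the displacements `a • v` and `b • v` to zero.
    set s := b / (b - a) with hs
    set t := -a / (b - a) with ht
    have hs0 : 0 ≤ s := div_nonneg hb.le hden.le
    have ht0 : 0 ≤ t := div_nonneg (by linarith) hden.le
    have hst : s + t = 1 := by rw [hs, ht]; field_simp; ring
    have hzero : s * a + t * b = 0 := by rw [hs, ht]; field_simp; ring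
    calc maxFactor C K m = s * maxFactor C K m + t * maxFactor C K m := by
          rw [← add_mul, hst, one_mul]
      _ ≤ s * ∑ i, maxFactor C (V i ∩ (a • v +ᵥ K)) m
          + t * ∑ i, maxFactor C (V i ∩ (b • v +ᵥ K)) m :=
        add_le_add (mul_le_mul_of_nonneg_left h1 hs0) (mul_le_mul_of_nonneg_left h2 ht0)
      _ = ∑ i, (s * maxFactor C (V i ∩ (a • v +ᵥ K)) m
          + t * maxFactor C (V i ∩ (b • v +ᵥ K)) m) := by
        rw [Finset.mul_sum, Finset.mul_sum, Finset.sum_add_distrib]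
      _ ≤ ∑ i, maxFactor C (V i ∩ K) m := Finset.sum_le_sum fun i _ => by
        refine maxFactor_combo hd hC (hcpt hKa i) (hane i) (hcpt hKb i) (hbne i) (hcpt hK i)
          hs0 ht0 ?_
        rintro _ ⟨_, ⟨_, ⟨hx, x, hxK, rfl⟩, rfl⟩, _, ⟨_, ⟨hy, y, hyK, rfl⟩, rfl⟩, rfl⟩
        refine ⟨hV.1.convex i hx hy hs0 ht0 hst, ?_⟩
        have := hK.convex hxK hyK hs0 ht0 hst
        convert this using 1
        calc s • (a • v + x) + t • (b • v + y) = (s * a + t * b) • v + (s • x + t • y) := by module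
          _ = s • x + t • y := by rw [hzero, zero_smul, zero_add]

end Partition

theorem theorem2p2 (d : ℕ) (hd : 2 ≤ d) (K C : Set (EuclideanSpace ℝ (Fin d)))
    (hK : IsConvexBody K) (hC : IsConvexBody C) (m : ℕ) (hm : 1 ≤ m)
    (n : ℕ) (V : Fin n → Set (EuclideanSpace ℝ (Fin d))) (hV : IsInductivePartition n V)
    (hVK : ∀ i, (interior (V i ∩ K)).Nonempty) :
    (∃! ρ : ℝ, IsSuccessiveInradius C K m ρ) ∧
    (∀ i, ∃! ρ : ℝ, IsSuccessiveInradius C (V i ∩ K) m ρ) ∧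
    successiveInradius C K m ≤ ∑ i, successiveInradius C (V i ∩ K) m := by
  have hd0 : 0 < d := by omega
  have hVi : ∀ i, IsConvexBody (V i ∩ K) := fun i =>
    ⟨(hV.isClosed_and_convex i).2.inter hK.convex,
      hK.isCompact.inter_left (hV.isClosed_and_convex i).1, hVK i⟩
  refine ⟨existsUnique_isSuccessiveInradius hd0 hC hK hm,
    fun i => existsUnique_isSuccessiveInradius hd0 hC (hVi i) hm, ?_⟩
  rw [successiveInradius_eq_maxFactor hd0 hC hK hm,
    Finset.sum_congr rfl fun i _ => successiveInradius_eq_maxFactor hd0 hC (hVi i) hm]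
  exact maxFactor_le_sum hd0 hC n V hV K hK
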